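/- Let $d\ge 2$ and let $G$ be the free group on $d$ generators $e_1,\dots,e_d$. Let $\xi_1,\xi_2,\dots$ be independent random letters, each uniformly distributed on the $2d$ elements $e_1,e_1^{-1},\dots,e_d,e_d^{-1}$. For $n\ge 0$ let $\hat w_n=a_1\cdots a_{L_n}$ be the reduced word of $\xi_1\xi_2\cdots\xi_n$ (each $a_j$ is a generator or the inverse of a generator), let $L_n$ be its length, and let $T_n=\#\{\,1\le j\le L_n-1 : a_j\ne a_{j+1}\,\}$ be its number of turns. Then, as $n\to\infty$, $$\frac{1}{\sqrt n}\Bigl(L_n-\frac{d-1}{d}\,n\Bigr)\longrightarrow N\Bigl(0,\frac{2d-1}{d^2}\Bigr)\quad\text{in distribution,}$$ and $$\frac{1}{\sqrt n}\Bigl(T_n-\frac{2(d-1)^2}{d(2d-1)}\,n\Bigr)\longrightarrow N\Bigl(0,\frac{2(d-1)^2(5d-2)}{d^2(2d-1)^2}\Bigr)\quad\text{in distribution,}$$ where $N(0,v)$ is the normal distribution with mean $0$ and variance $v$. -/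

import Mathlib

open Filter MeasureTheory ProbabilityTheory

namespace ReducedWalk

/-- A letter over the alphabet `e_1, …, e_d`: `(i, true)` stands for the generator `e_i` and
`(i, false)` for its inverse. This is also the encoding of letters in `FreeGroup.toWord`. -/
abbrev Letter (d : ℕ) : Type := Fin d × Bool

/-- The element of the free group given by a letter. -/
def letter {d : ℕ} (a : Letter d) : FreeGroup (Fin d) :=
  if a.2 then FreeGroup.of a.1 else (FreeGroup.of a.1)⁻¹

/-- The position after `n` steps: start at the identity (the empty word) and multiply successively
on the right by the letters `x 0, …, x (n - 1)`. -/
def position {d : ℕ} (x : ℕ → Letter d) : ℕ → FreeGroup (Fin d)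
  | 0 => 1
  | n + 1 => position x n * letter (x n)

/-- The length of the reduced word after `n` steps. -/
def reducedLength {d : ℕ} (x : ℕ → Letter d) (n : ℕ) : ℕ :=
  (position x n).toWord.length

/-- The number of places at which two consecutive letters of the word `w` differ. -/
def turns {d : ℕ} (w : List (Letter d)) : ℕ :=
  (w.zip w.tail).countP (fun p => p.1 ≠ p.2)

/-- The number of turns of the reduced word after `n` steps. -/
def numTurns {d : ℕ} (x : ℕ → Letter d) (n : ℕ) : ℕ :=
  turns (position x n).toWord

end ReducedWalk

/-! Inverting the position preserves length and turns and moves each new letter to the head of the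
word, giving a Markov chain on lists (`word_eq`, `integral_word`). Away from the empty word, `u ^
length` is an eigenfunction of its transition operator with eigenvalue `multiplier d u`. The defect
sits at the empty word, where return probabilities decay like `(7/8) ^ n`, so the expectation of `u
^ length` is `multiplier d u ^ n` up to an error that vanishes as `u → 1`
(`norm_transition_pow_powLength_sub_le`). The chain is uniform on each sphere, so given a positive
length the turns are binomial: the expectation of `z ^ turns` is that of `u ^ length` at `u = 1 + p
(z - 1)`, `p = (2d-2)/(2d-1)`, up to a boundary correction (`transition_pow_powTurns`). Both limits
thus follow from one second-order expansion of the multiplier at `1 + p (exp (i s) - 1)`, with `p =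
1` for the length, and convergence of characteristic functions. -/

namespace ReducedWalk

variable {d : ℕ}

/-! ### The reduced word as a Markov chain on lists of letters -/

/-- The inverse letter. -/
def flip (a : Letter d) : Letter d := (a.1, !a.2)

@[simp] lemma flip_flip (a : Letter d) : flip (flip a) = a := by simp [flip]

lemma flip_injective : Function.Injective (flip (d := d)) :=
  Function.LeftInverse.injective flip_flip

lemma flip_ne (a : Letter d) : flip a ≠ a := by
  simp [flip, Prod.ext_iff]

/-- Put a letter in front of a word and cancel if possible. -/
def step (a : Letter d) : List (Letter d) → List (Letter d)
  | [] => [a]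
  | b :: l => if a = flip b then l else a :: b :: l

/-- The reduced word of the inverse of the position after `n` steps. -/
def word (x : ℕ → Letter d) : ℕ → List (Letter d)
  | 0 => []
  | n + 1 => step (flip (x n)) (word x n)

lemma word_congr {x y : ℕ → Letter d} {n : ℕ} (h : ∀ i < n, x i = y i) :
    word x n = word y n := by
  induction n with
  | zero => rfl
  | succ n ih =>
    rw [word, word, ih fun i hi => h i (by omega), h n (by omega)]

lemma letter_inv (a : Letter d) : (letter a)⁻¹ = FreeGroup.mk [flip a] := by
  obtain ⟨i, b⟩ := a
  cases b <;> simp [letter, flip, FreeGroup.of, FreeGroup.invRev]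

lemma toWord_mk_singleton_mul (a : Letter d) (g : FreeGroup (Fin d)) :
    (FreeGroup.mk [a] * g).toWord = step a g.toWord := by
  rw [FreeGroup.toWord_mul, FreeGroup.toWord_mk, FreeGroup.reduce_singleton, List.singleton_append,
    FreeGroup.reduce.cons, FreeGroup.reduce_toWord]
  cases g.toWord with
  | nil => rfl
  | cons b l => simp [step, flip, Prod.ext_iff]

lemma word_eq (x : ℕ → Letter d) (n : ℕ) : word x n = (position x n)⁻¹.toWord := by
  induction n with
  | zero => simp [word, position]
  | succ n ih =>
    rw [word, ih, position, mul_inv_rev, letter_inv, toWord_mk_singleton_mul]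

lemma length_word (x : ℕ → Letter d) (n : ℕ) : (word x n).length = reducedLength x n := by
  rw [word_eq, FreeGroup.toWord_inv, reducedLength, FreeGroup.invRev_length]

lemma turns_cons_cons (a b : Letter d) (l : List (Letter d)) :
    turns (a :: b :: l) = turns (b :: l) + if a = b then 0 else 1 := by
  simp [turns, List.countP_cons]

lemma turns_append_pair (l : List (Letter d)) (a b : Letter d) :
    turns (l ++ [a, b]) = turns (l ++ [a]) + if a = b then 0 else 1 := by
  induction l with
  | nil => simp [turns, List.countP_cons]
  | cons c l ih =>
    cases l with
    | nil => simp [turns, List.countP_cons]; omega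
    | cons e l =>
      simp only [List.cons_append, turns_cons_cons] at ih ⊢
      omega

lemma turns_reverse (l : List (Letter d)) : turns l.reverse = turns l := by
  induction l with
  | nil => rfl
  | cons a l ih =>
    cases l with
    | nil => rfl
    | cons b l =>
      rw [turns_cons_cons, ← ih]
      simp only [List.reverse_cons, List.append_assoc, List.cons_append, List.nil_append]
      rw [turns_append_pair]
      simp only [eq_comm]

lemma turns_map_flip (l : List (Letter d)) : turns (l.map flip) = turns l := by
  induction l with
  | nil => rfl
  | cons a l ih =>
    cases l with
    | nil => rfl
    | cons b l =>
      simp only [List.map_cons, turns_cons_cons, flip_injective.eq_iff] at ih ⊢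
      rw [ih]

lemma turns_word (x : ℕ → Letter d) (n : ℕ) : turns (word x n) = numTurns x n := by
  rw [word_eq, FreeGroup.toWord_inv, numTurns]
  exact (turns_reverse _).trans (turns_map_flip _)

/-! ### The transition operator -/

/-- Sum over all extensions of a word by a letter that does not cancel. -/
noncomputable def extendSum (d : ℕ) : (List (Letter d) → ℂ) →ₗ[ℂ] (List (Letter d) → ℂ) where
  toFun F w := ∑ a : Letter d, if w.head? = some (flip a) then 0 else F (a :: w)
  map_add' F G := by
    ext w
    simp only [Pi.add_apply, ← Finset.sum_add_distrib]
    exact Finset.sum_congr rfl fun a _ => by split_ifs <;> simp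
  map_smul' c F := by
    ext w
    simp [Finset.mul_sum]

/-- Remove the first letter, if there is one. -/
def dropHead (d : ℕ) : (List (Letter d) → ℂ) →ₗ[ℂ] (List (Letter d) → ℂ) where
  toFun F w := match w with
    | [] => 0
    | _ :: l => F l
  map_add' F G := by ext w; cases w <;> simp
  map_smul' c F := by ext w; cases w <;> simp

/-- The transition operator of the chain `word`. -/
noncomputable def transition (d : ℕ) : (List (Letter d) → ℂ) →ₗ[ℂ] (List (Letter d) → ℂ) :=
  (2 * d : ℂ)⁻¹ • (extendSum d + dropHead d)

@[simp] lemma dropHead_nil (F : List (Letter d) → ℂ) : dropHead d F [] = 0 := rfl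

@[simp] lemma dropHead_cons (F : List (Letter d) → ℂ) (b : Letter d) (l : List (Letter d)) :
    dropHead d F (b :: l) = F l := rfl

lemma extendSum_nil (F : List (Letter d) → ℂ) : extendSum d F [] = ∑ a, F [a] := by
  simp [extendSum]

lemma extendSum_cons (F : List (Letter d) → ℂ) (b : Letter d) (l : List (Letter d)) :
    extendSum d F (b :: l) = ∑ a ∈ Finset.univ.erase (flip b), F (a :: b :: l) := by
  simp only [extendSum, LinearMap.coe_mk, AddHom.coe_mk, List.head?_cons, Option.some.injEq]
  rw [← Finset.add_sum_erase _ _ (Finset.mem_univ (flip b))]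
  simp only [flip_flip, if_true, zero_add]
  refine Finset.sum_congr rfl fun a ha => if_neg fun h => Finset.ne_of_mem_erase ha ?_
  rw [h, flip_flip]

lemma transition_apply (F : List (Letter d) → ℂ) (w : List (Letter d)) :
    transition d F w = (2 * d : ℂ)⁻¹ * ∑ a, F (step a w) := by
  simp only [transition, LinearMap.smul_apply, LinearMap.add_apply, Pi.smul_apply, Pi.add_apply,
    smul_eq_mul]
  congr 1
  cases w with
  | nil => simp [extendSum_nil, step]
  | cons b l =>
    rw [extendSum_cons, dropHead_cons, ← Finset.add_sum_erase _ _ (Finset.mem_univ (flip b)),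
      add_comm]
    congr 1
    · simp [step]
    · exact Finset.sum_congr rfl fun a ha => by simp [step, Finset.ne_of_mem_erase ha]

lemma card_letter : Fintype.card (Letter d) = 2 * d := by
  simp [mul_comm]

lemma card_erase_letter (hd : 2 ≤ d) (b : Letter d) :
    ((Finset.univ.erase b).card : ℂ) = 2 * d - 1 := by
  rw [Finset.card_erase_of_mem (Finset.mem_univ b), Finset.card_univ, card_letter,
    Nat.cast_sub (by omega)]
  push_cast
  rfl

lemma extendSum_congr {F G : List (Letter d) → ℂ} (h : ∀ a l, F (a :: l) = G (a :: l)) :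
    extendSum d F = extendSum d G := by
  ext w
  simp [extendSum, h]

/-- Summing `dropHead F` over a sphere gives a multiple of the sum of `F` over the previous one. -/
lemma extendSum_pow_dropHead (hd : 2 ≤ d) (F : List (Letter d) → ℂ) (k : ℕ) :
    (extendSum d ^ (k + 1)) (dropHead d F) [] =
      (if k = 0 then (2 * d : ℂ) else 2 * d - 1) * (extendSum d ^ k) F [] := by
  have hcons (b : Letter d) (l : List (Letter d)) :
      extendSum d (dropHead d F) (b :: l) = ((2 * d - 1 : ℂ) • F) (b :: l) := by
    simp only [extendSum_cons, dropHead_cons, Finset.sum_const, nsmul_eq_mul,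
      card_erase_letter hd, Pi.smul_apply, smul_eq_mul]
  rw [pow_succ, Module.End.mul_apply]
  cases k with
  | zero =>
    simp [extendSum_nil, mul_comm]
  | succ k =>
    rw [pow_succ, Module.End.mul_apply, extendSum_congr hcons, map_smul, map_smul,
      Module.End.mul_apply]
    simp

/-- The distribution of the chain started at the empty word is radial: expectations depend only on
sums over spheres. -/
lemma transition_pow_eq_of_sphere (hd : 2 ≤ d) (n : ℕ) {F G : List (Letter d) → ℂ}
    (h : ∀ k, (extendSum d ^ k) F [] = (extendSum d ^ k) G []) :
    (transition d ^ n) F [] = (transition d ^ n) G [] := by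
  induction n generalizing F G with
  | zero => simpa using h 0
  | succ n ih =>
    rw [pow_succ, Module.End.mul_apply, Module.End.mul_apply]
    refine ih fun k => ?_
    simp only [transition, LinearMap.smul_apply, LinearMap.add_apply, map_smul, map_add,
      Pi.smul_apply, Pi.add_apply, ← Module.End.mul_apply, ← pow_succ]
    rw [h (k + 1)]
    congr 2
    cases k with
    | zero => simp
    | succ k =>
      have := h k
      simp only [Module.End.mul_apply, extendSum_pow_dropHead hd, this]

/-- Words reached after one extension are nonempty, so the eigenvalue relation is not needed at
`[]`; the first extension contributes the sum over single letters. -/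
lemma extendSum_pow_of_eigen {F : List (Letter d) → ℂ} {κ : ℂ}
    (hF : ∀ b l, extendSum d F (b :: l) = κ * F (b :: l)) (k : ℕ) :
    (extendSum d ^ (k + 1)) F [] = κ ^ k * ∑ a, F [a] := by
  induction k with
  | zero => simp [extendSum_nil]
  | succ k ih =>
    have h2 : extendSum d (extendSum d F) = κ • extendSum d F := by
      rw [← map_smul]
      exact extendSum_congr fun a l => by simp [hF]
    rw [pow_succ, pow_succ, Module.End.mul_apply, Module.End.mul_apply, h2, map_smul,
      Pi.smul_apply, smul_eq_mul, ← Module.End.mul_apply, ← pow_succ, ih]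
    ring

/-! ### Generating functions of length and turns -/

/-- The indicator function of the empty word. -/
def emptyInd (d : ℕ) (w : List (Letter d)) : ℂ := if w = [] then 1 else 0

/-- `u` to the power the length of the word. -/
noncomputable def powLength (d : ℕ) (u : ℂ) (w : List (Letter d)) : ℂ := u ^ w.length

/-- `z` to the power the number of turns of the word. -/
noncomputable def powTurns (d : ℕ) (z : ℂ) (w : List (Letter d)) : ℂ := z ^ turns w

lemma extendSum_powLength_cons (hd : 2 ≤ d) (u : ℂ) (b : Letter d) (l : List (Letter d)) :
    extendSum d (powLength d u) (b :: l) = ((2 * d - 1) * u) * powLength d u (b :: l) := by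
  simp only [extendSum_cons, powLength, List.length_cons, Finset.sum_const, nsmul_eq_mul,
    card_erase_letter hd]
  ring

lemma extendSum_powTurns_cons (hd : 2 ≤ d) (z : ℂ) (b : Letter d) (l : List (Letter d)) :
    extendSum d (powTurns d z) (b :: l) = (1 + (2 * d - 2) * z) * powTurns d z (b :: l) := by
  have hb : b ∈ Finset.univ.erase (flip b) := by simp [(flip_ne b).symm]
  rw [extendSum_cons, ← Finset.add_sum_erase _ _ hb]
  have h (a : Letter d) (ha : a ∈ (Finset.univ.erase (flip b)).erase b) :
      powTurns d z (a :: b :: l) = powTurns d z (b :: l) * z := by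
    simp [powTurns, turns_cons_cons, Finset.ne_of_mem_erase ha, pow_succ]
  rw [Finset.sum_congr rfl h, Finset.sum_const, nsmul_eq_mul, Finset.card_erase_of_mem hb,
    Nat.cast_sub (Finset.card_pos.2 ⟨b, hb⟩), card_erase_letter hd]
  simp only [powTurns, turns_cons_cons, if_true, Nat.cast_one, add_zero]
  ring

/-- By radiality it suffices to match sphere sums. At radius `k + 1` they are `2d (1 + (2d-2) z) ^
k` and `2d u ((2d-1) u) ^ k`, so `hzu` leaves only a factor `u⁻¹`; the `emptyInd` term repairs
radius 0. -/
lemma transition_pow_powTurns (hd : 2 ≤ d) (n : ℕ) {z u : ℂ} (hu : u ≠ 0)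
    (hzu : (2 * d - 1) * u = 1 + (2 * d - 2) * z) :
    (transition d ^ n) (powTurns d z) [] =
      u⁻¹ * (transition d ^ n) (powLength d u) [] +
        (1 - u⁻¹) * (transition d ^ n) (emptyInd d) [] := by
  have key : (transition d ^ n) (powTurns d z) [] =
      (transition d ^ n) (u⁻¹ • powLength d u + (1 - u⁻¹) • emptyInd d) [] := by
    refine transition_pow_eq_of_sphere hd n fun k => ?_
    cases k with
    | zero => simp [powTurns, powLength, emptyInd, turns]
    | succ k =>
      have h0 : extendSum d (emptyInd d) = 0 := by
        ext w
        simp [extendSum, emptyInd]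
      rw [extendSum_pow_of_eigen (extendSum_powTurns_cons hd z), map_add, map_smul, map_smul,
        pow_succ (extendSum d) k, Module.End.mul_apply (extendSum d ^ k) _ (emptyInd d), h0,
        ← pow_succ, Pi.add_apply, Pi.smul_apply,
        extendSum_pow_of_eigen (extendSum_powLength_cons hd u), hzu]
      simp [powTurns, powLength, turns]
      field_simp
  rw [key]
  simp

/-! ### Approximate eigenfunctions and return probabilities -/

/-- The multiplier of the length away from the empty word. -/
noncomputable def multiplier (d : ℕ) (u : ℂ) : ℂ := (2 * d : ℂ)⁻¹ * ((2 * d - 1) * u + u⁻¹)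

lemma transition_powLength (hd : 2 ≤ d) {u : ℂ} (hu : u ≠ 0) :
    transition d (powLength d u) =
      multiplier d u • powLength d u + ((2 * d : ℂ)⁻¹ * (u - u⁻¹)) • emptyInd d := by
  ext w
  simp only [transition, LinearMap.smul_apply, LinearMap.add_apply, Pi.smul_apply, Pi.add_apply,
    smul_eq_mul, multiplier]
  cases w with
  | nil =>
    simp [extendSum_nil, powLength, emptyInd]
    ring
  | cons b l =>
    rw [extendSum_powLength_cons hd]
    simp [powLength, emptyInd, pow_succ]
    field_simp

/-- The drift away from `[]` makes `2 ^ (-length)` contract: the factor is `1/2 + 3/(4d) ≤ 7/8` at a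
nonempty word, with equality at `d = 2`, and `1/2` at `[]`. -/
lemma norm_transition_le (hd : 2 ≤ d) {F : List (Letter d) → ℂ} {C : ℝ}
    (hF : ∀ w, ‖F w‖ ≤ C * (1 / 2) ^ w.length) (w : List (Letter d)) :
    ‖transition d F w‖ ≤ C * (7 / 8) * (1 / 2) ^ w.length := by
  have hd' : (2 : ℝ) ≤ d := by exact_mod_cast hd
  have hC : 0 ≤ C := by simpa using (norm_nonneg _).trans (hF [])
  rw [transition_apply, norm_mul, norm_inv]
  have hn : ‖(2 * d : ℂ)‖ = 2 * d := by simp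
  rw [hn, inv_mul_le_iff₀ (by positivity)]
  refine (norm_sum_le _ _).trans ((Finset.sum_le_sum fun a _ => hF (step a w)).trans ?_)
  cases w with
  | nil =>
    simp only [step, List.length_singleton, Finset.sum_const, nsmul_eq_mul, Finset.card_univ,
      card_letter, List.length_nil]
    push_cast
    nlinarith [mul_nonneg (show (0 : ℝ) ≤ d by linarith) hC]
  | cons b l =>
    have h (a : Letter d) (ha : a ∈ Finset.univ.erase (flip b)) :
        C * (1 / 2 : ℝ) ^ (step a (b :: l)).length = C * (1 / 2) ^ (l.length + 2) := by
      simp [step, Finset.ne_of_mem_erase ha]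
    rw [← Finset.add_sum_erase _ _ (Finset.mem_univ (flip b)), Finset.sum_congr rfl h,
      Finset.sum_const, nsmul_eq_mul, Finset.card_erase_of_mem (Finset.mem_univ _),
      Finset.card_univ, card_letter, Nat.cast_sub (by omega)]
    simp only [step, if_true, List.length_cons, pow_succ]
    push_cast
    have := mul_nonneg hC (pow_nonneg (show (0 : ℝ) ≤ 1 / 2 by norm_num) l.length)
    nlinarith

lemma norm_return_le (hd : 2 ≤ d) (n : ℕ) :
    ‖(transition d ^ n) (emptyInd d) []‖ ≤ (7 / 8 : ℝ) ^ n := by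
  suffices h : ∀ w, ‖(transition d ^ n) (emptyInd d) w‖ ≤ (7 / 8 : ℝ) ^ n * (1 / 2) ^ w.length by
    simpa using h []
  induction n with
  | zero =>
    intro w
    cases w <;> simp [emptyInd]
  | succ n ih =>
    intro w
    rw [pow_succ', Module.End.mul_apply, pow_succ]
    exact norm_transition_le hd ih w

lemma norm_transition_pow_powLength_sub_le (hd : 2 ≤ d) (n : ℕ) {u : ℂ} (hu : u ≠ 0) :
    ‖(transition d ^ n) (powLength d u) [] - multiplier d u ^ n‖ ≤
      8 * ‖(2 * d : ℂ)⁻¹ * (u - u⁻¹)‖ * max 1 ‖multiplier d u‖ ^ n := by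
  set c := (2 * d : ℂ)⁻¹ * (u - u⁻¹)
  set m := max 1 ‖multiplier d u‖
  have hm : 1 ≤ m := le_max_left _ _
  -- The factor `8 (1 - (7/8) ^ n)` is the partial geometric sum of the return bounds, kept exact so
  -- that the induction closes.
  suffices h : ‖(transition d ^ n) (powLength d u) [] - multiplier d u ^ n‖ ≤
      ‖c‖ * m ^ n * (8 * (1 - (7 / 8 : ℝ) ^ n)) by
    refine h.trans ?_
    have h1 : (0 : ℝ) ≤ (7 / 8 : ℝ) ^ n := by positivity
    have h2 : 0 ≤ ‖c‖ * m ^ n := by positivity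
    nlinarith
  induction n with
  | zero => simp [powLength]
  | succ n ih =>
    have e : (transition d ^ (n + 1)) (powLength d u) [] - multiplier d u ^ (n + 1) =
        multiplier d u * ((transition d ^ n) (powLength d u) [] - multiplier d u ^ n) +
          c * (transition d ^ n) (emptyInd d) [] := by
      rw [pow_succ, Module.End.mul_apply, transition_powLength hd hu]
      simp only [map_add, map_smul, Pi.add_apply, Pi.smul_apply, smul_eq_mul]
      ring
    rw [e]
    refine (norm_add_le _ _).trans ?_
    rw [norm_mul, norm_mul]
    have h1 : ‖multiplier d u‖ * ‖(transition d ^ n) (powLength d u) [] - multiplier d u ^ n‖ ≤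
        m * (‖c‖ * m ^ n * (8 * (1 - (7 / 8 : ℝ) ^ n))) := by
      gcongr
      exact le_max_right _ _
    have h2 : ‖c‖ * ‖(transition d ^ n) (emptyInd d) []‖ ≤ ‖c‖ * m ^ (n + 1) * (7 / 8 : ℝ) ^ n := by
      have h3 := norm_return_le hd n
      have h4 : 1 ≤ m ^ (n + 1) := one_le_pow₀ hm
      calc _ ≤ ‖c‖ * 1 * (7 / 8 : ℝ) ^ n := by rw [mul_one]; gcongr
        _ ≤ _ := by gcongr
    refine (add_le_add h1 h2).trans (le_of_eq ?_)
    ring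

end ReducedWalk

namespace ReducedWalk

/-! ### Asymptotics of the multiplier -/

open Complex Topology

lemma tendsto_exp_mul_I_sub_one_div (θ : ℝ) :
    Tendsto (fun s : ℝ => (exp (θ * s * I) - 1) / s) (𝓝[≠] 0) (𝓝 (θ * I)) := by
  have h : HasDerivAt (fun s : ℝ => exp (θ * s * I)) (θ * I) 0 := by
    have h1 : HasDerivAt (fun s : ℝ => (θ * s * I : ℂ)) (θ * I) 0 := by
      simpa using (((hasDerivAt_id (0 : ℝ)).ofReal_comp).const_mul (θ : ℂ)).mul_const I
    simpa using h1.cexp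
  refine (h.tendsto_slope).congr fun s => ?_
  simp [slope, div_eq_inv_mul]

lemma tendsto_exp_mul_I_sub_linear_div_sq (θ : ℝ) :
    Tendsto (fun s : ℝ => (exp (θ * s * I) - 1 - θ * s * I) / s ^ 2) (𝓝[≠] 0)
      (𝓝 (-(θ : ℂ) ^ 2 / 2)) := by
  have h0 : Tendsto (fun s : ℝ => (θ * s * I : ℂ)) (𝓝[≠] 0) (𝓝 0) :=
    (Continuous.tendsto' (by fun_prop) 0 0 (by simp)).mono_left nhdsWithin_le_nhds
  have h1 := (exp_sub_sum_range_succ_isLittleO_pow 2).comp_tendsto h0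
  have h2 : (fun s : ℝ => exp (θ * s * I) - 1 - θ * s * I - (-(θ : ℂ) ^ 2 / 2) * s ^ 2)
      =o[𝓝[≠] 0] fun s : ℝ => (s : ℂ) ^ 2 := by
    refine (h1.congr_left fun s => ?_).trans_isBigO ?_
    · simp [Finset.sum_range_succ, mul_pow]
      ring
    · refine Asymptotics.IsBigO.of_bound (θ ^ 2) (Eventually.of_forall fun s => ?_)
      simp [mul_pow]
  have h3 := (h2.tendsto_div_nhds_zero).add_const (-(θ : ℂ) ^ 2 / 2)
  rw [zero_add] at h3
  refine h3.congr' ?_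
  filter_upwards [self_mem_nhdsWithin] with s hs
  have : (s : ℂ) ≠ 0 := by simpa using hs
  field_simp
  ring

variable {d : ℕ}

/-- The generating function of a Bernoulli variable with parameter `p`, on the unit circle. -/
noncomputable def bernoulliChar (p s : ℝ) : ℂ := 1 + p * (exp (s * I) - 1)

/-- The speed of a chain with length multiplier thinned by `p`. -/
noncomputable def speed (d : ℕ) (p : ℝ) : ℝ := (d - 1) / d * p

/-- The asymptotic variance of a chain with length multiplier thinned by `p`. -/
noncomputable def asympVar (d : ℕ) (p : ℝ) : ℝ := speed d p + p ^ 2 / d - speed d p ^ 2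

lemma tendsto_bernoulliChar (p : ℝ) : Tendsto (bernoulliChar p) (𝓝 0) (𝓝 1) :=
  Continuous.tendsto' (by unfold bernoulliChar; fun_prop) 0 1 (by simp [bernoulliChar])

lemma tendsto_multiplier_sub_one_div_sq (hd : 2 ≤ d) (p : ℝ) :
    Tendsto (fun s : ℝ => (multiplier d (bernoulliChar p s) * exp (-speed d p * s * I) - 1) / s ^ 2)
      (𝓝[≠] 0) (𝓝 (-(asympVar d p : ℂ) / 2)) := by
  have hd0 : (d : ℂ) ≠ 0 := by norm_cast; omega
  set m := speed d p with hm
  have hy1 := tendsto_exp_mul_I_sub_one_div 1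
  have hy2 := tendsto_exp_mul_I_sub_linear_div_sq 1
  have he1 := tendsto_exp_mul_I_sub_one_div (-m)
  have he2 := tendsto_exp_mul_I_sub_linear_div_sq (-m)
  have he : Tendsto (fun s : ℝ => exp (-m * s * I)) (𝓝[≠] 0) (𝓝 1) :=
    (Continuous.tendsto' (by fun_prop) 0 1 (by simp)).mono_left nhdsWithin_le_nhds
  have hu := (tendsto_bernoulliChar p).mono_left (nhdsWithin_le_nhds (s := {0}ᶜ))
  have hu0 : ∀ᶠ s in 𝓝[≠] (0 : ℝ), bernoulliChar p s ≠ 0 :=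
    hu.eventually_ne one_ne_zero
  -- With `y = exp (i s) - 1`, `u = 1 + p y` and `E = exp (-i m s)`, the multiplier is `1 + m y + p²
  -- y² / (2d u)`. The four summands are the limits of `(E - 1 + i m s)/s²`, `m (y - i s) E/s²`, `i
  -- m (E - 1)/s` and `p² y² E/(2d u s²)`; the first-order terms cancel because `m` is the speed.
  have hlim := ((he2.add ((hy2.mul he).const_mul (m : ℂ))).add
    (he1.const_mul (m * I : ℂ))).add
    ((((hy1.pow 2).mul he).div hu one_ne_zero).const_mul (p ^ 2 / (2 * d) : ℂ))
  have hval : (-((-m : ℝ) : ℂ) ^ 2 / 2 + m * (-((1 : ℝ) : ℂ) ^ 2 / 2 * 1) + m * I * ((-m : ℝ) * I) +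
      p ^ 2 / (2 * d) * (((1 : ℝ) * I) ^ 2 * 1 / 1)) = -asympVar d p / 2 := by
    simp only [asympVar, ← hm]
    push_cast
    linear_combination ((p : ℂ) ^ 2 / (2 * d) - m ^ 2) * I_sq
  rw [hval] at hlim
  refine hlim.congr' ?_
  filter_upwards [self_mem_nhdsWithin, hu0] with s hs hus
  have hs' : (s : ℂ) ≠ 0 := by simpa using hs
  have hmc : (m : ℂ) = (d - 1) / d * p := by simp [hm, speed]
  have hmult : multiplier d (bernoulliChar p s) = 1 + m * (exp (s * I) - 1) +
      p ^ 2 / (2 * d) * ((exp (s * I) - 1) ^ 2 / bernoulliChar p s) := by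
    rw [multiplier, hmc]
    field_simp
    simp only [bernoulliChar]
    ring
  rw [hmult]
  simp only [Pi.div_apply, ofReal_neg, ofReal_one, one_mul]
  field_simp
  ring

lemma tendsto_multiplier_pow (hd : 2 ≤ d) (p t : ℝ) :
    Tendsto (fun n : ℕ => (multiplier d (bernoulliChar p (t / √n)) *
      exp (-speed d p * ↑(t / √n) * I)) ^ n) atTop (𝓝 (exp (-(asympVar d p * t ^ 2 / 2)))) := by
  rcases eq_or_ne t 0 with rfl | ht
  · have hd0 : (d : ℂ) ≠ 0 := by norm_cast; omega
    have : multiplier d 1 = 1 := by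
      simp only [multiplier]
      field_simp
      ring
    simp [bernoulliChar, this]
  have hs : Tendsto (fun n : ℕ => t / √(n : ℝ)) atTop (𝓝[≠] 0) := by
    refine tendsto_nhdsWithin_iff.2 ⟨?_, ?_⟩
    · exact tendsto_const_nhds.div_atTop
        (Real.tendsto_sqrt_atTop.comp tendsto_natCast_atTop_atTop)
    · filter_upwards [eventually_gt_atTop 0] with n hn
      have : (0 : ℝ) < n := by exact_mod_cast hn
      exact div_ne_zero ht (by positivity)
  have h := ((tendsto_multiplier_sub_one_div_sq hd p).comp hs).const_mul ((t : ℂ) ^ 2)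
  have h2 : Tendsto (fun n : ℕ => (n : ℂ) * (multiplier d (bernoulliChar p (t / √n)) *
      exp (-speed d p * ↑(t / √n) * I) - 1)) atTop (𝓝 (-(asympVar d p * t ^ 2 / 2))) := by
    have e : (t : ℂ) ^ 2 * (-asympVar d p / 2) = -(asympVar d p * t ^ 2 / 2) := by ring
    rw [← e]
    refine h.congr' ?_
    filter_upwards [eventually_gt_atTop 0] with n hn
    have hn' : (0 : ℝ) < n := by exact_mod_cast hn
    have hsq : (((t / √(n : ℝ) : ℝ) : ℂ)) ^ 2 = t ^ 2 / n := by
      norm_cast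
      rw [div_pow, Real.sq_sqrt hn'.le]
    have ht' : (t : ℂ) ≠ 0 := by exact_mod_cast ht
    have hn'' : (n : ℂ) ≠ 0 := by exact_mod_cast hn.ne'
    simp only [Function.comp_apply, hsq]
    field_simp
  simpa using tendsto_one_add_pow_exp_of_tendsto h2

lemma tendsto_bernoulliChar_div_sqrt (p t : ℝ) :
    Tendsto (fun n : ℕ => bernoulliChar p (t / √n)) atTop (𝓝 1) :=
  (tendsto_bernoulliChar p).comp (tendsto_const_nhds.div_atTop
    (Real.tendsto_sqrt_atTop.comp tendsto_natCast_atTop_atTop))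

lemma norm_exp_speed (m s : ℝ) : ‖exp (-m * s * I)‖ = 1 := by
  have : (-m * s * I : ℂ) = ((-m * s : ℝ) : ℂ) * I := by push_cast; ring
  rw [this, norm_exp_ofReal_mul_I]

lemma tendsto_powLength (hd : 2 ≤ d) (p t : ℝ) :
    Tendsto (fun n : ℕ => (transition d ^ n) (powLength d (bernoulliChar p (t / √n))) [] *
      exp (-speed d p * ↑(t / √n) * I) ^ n) atTop (𝓝 (exp (-(asympVar d p * t ^ 2 / 2)))) := by
  have hpow := tendsto_multiplier_pow hd p t
  have hu := tendsto_bernoulliChar_div_sqrt p t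
  have hc : Tendsto (fun n : ℕ => ‖(2 * d : ℂ)⁻¹ * (bernoulliChar p (t / √n) -
      (bernoulliChar p (t / √n))⁻¹)‖) atTop (𝓝 0) := by
    simpa using ((hu.sub (hu.inv₀ one_ne_zero)).const_mul (2 * d : ℂ)⁻¹).norm
  -- The centering factor has modulus 1, so the limit in `hpow` also controls the uncentered powers
  -- in the error bound.
  have hM : Tendsto (fun n : ℕ => max 1 ‖multiplier d (bernoulliChar p (t / √n))‖ ^ n) atTop
      (𝓝 (max 1 ‖exp (-(asympVar d p * t ^ 2 / 2))‖)) := by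
    refine (tendsto_const_nhds.max hpow.norm).congr fun n => ?_
    rw [norm_pow, norm_mul, norm_exp_speed, mul_one]
    rcases le_total 1 ‖multiplier d (bernoulliChar p (t / √n))‖ with h | h
    · rw [max_eq_right h, max_eq_right (one_le_pow₀ h)]
    · rw [max_eq_left h, max_eq_left (pow_le_one₀ (norm_nonneg _) h), one_pow]
  have hdiff : Tendsto (fun n : ℕ => (transition d ^ n) (powLength d (bernoulliChar p (t / √n))) [] *
      exp (-speed d p * ↑(t / √n) * I) ^ n - (multiplier d (bernoulliChar p (t / √n)) *
      exp (-speed d p * ↑(t / √n) * I)) ^ n) atTop (𝓝 0) := by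
    have hb := (hc.const_mul 8).mul hM
    rw [mul_zero, zero_mul] at hb
    refine squeeze_zero_norm' ?_ hb
    filter_upwards [hu.eventually_ne one_ne_zero] with n hn
    rw [mul_pow, ← sub_mul, norm_mul, norm_pow, norm_exp_speed, one_pow, mul_one]
    exact norm_transition_pow_powLength_sub_le hd n hn
  simpa using hdiff.add hpow

lemma tendsto_powTurns (hd : 2 ≤ d) (t : ℝ) {p : ℝ} (hp : p = (2 * d - 2) / (2 * d - 1)) :
    Tendsto (fun n : ℕ => (transition d ^ n) (powTurns d (exp (↑(t / √n) * I))) [] *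
      exp (-speed d p * ↑(t / √n) * I) ^ n) atTop (𝓝 (exp (-(asympVar d p * t ^ 2 / 2)))) := by
  have hu := tendsto_bernoulliChar_div_sqrt p t
  have hui := hu.inv₀ one_ne_zero
  have hd' : (2 * d - 1 : ℂ) ≠ 0 := by
    have : (2 * d - 1 : ℝ) ≠ 0 := by
      have : (2 : ℝ) ≤ d := by exact_mod_cast hd
      linarith
    exact_mod_cast this
  have hrest : Tendsto (fun n : ℕ => (1 - (bernoulliChar p (t / √n))⁻¹) *
      (transition d ^ n) (emptyInd d) [] * exp (-speed d p * ↑(t / √n) * I) ^ n) atTop (𝓝 0) := by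
    have h1 := (hui.const_sub 1).norm
    rw [inv_one, sub_self, norm_zero] at h1
    refine squeeze_zero_norm (fun n => ?_) h1
    rw [norm_mul, norm_mul, norm_pow, norm_exp_speed, one_pow, mul_one]
    refine mul_le_of_le_one_right (norm_nonneg _) ((norm_return_le hd n).trans ?_)
    exact pow_le_one₀ (by norm_num) (by norm_num)
  have hlim := (hui.mul (tendsto_powLength hd p t)).add hrest
  rw [inv_one, one_mul, add_zero] at hlim
  refine hlim.congr' ?_
  filter_upwards [hu.eventually_ne one_ne_zero] with n hn
  rw [transition_pow_powTurns hd n hn (z := exp (↑(t / √n) * I))]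
  · ring
  · simp only [bernoulliChar, hp]
    push_cast
    field_simp
    ring

end ReducedWalk

namespace ReducedWalk

/-! ### Convergence in distribution -/

lemma integral_indepFun_uniform {Ω α β : Type*} [MeasurableSpace Ω] {P : Measure Ω}
    [IsProbabilityMeasure P] [Finite α] [MeasurableSpace α] [MeasurableSingletonClass α]
    [Fintype β] [Nonempty β] [MeasurableSpace β] [MeasurableSingletonClass β]
    {X : Ω → α} {Y : Ω → β} (hX : AEMeasurable X P) (hY : HasLaw Y (uniformOn Set.univ) P)
    (hXY : IndepFun X Y P) (F : α → β → ℂ) :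
    ∫ ω, F (X ω) (Y ω) ∂P = ∫ ω, (Fintype.card β : ℂ)⁻¹ * ∑ b, F (X ω) b ∂P := by
  have hprob : IsProbabilityMeasure (P.map X) := Measure.isProbabilityMeasure_map hX
  have hint : Integrable (fun q : α × β => F q.1 q.2)
      ((P.map X).prod (uniformOn Set.univ)) := .of_finite
  have hlaw := (indepFun_iff_map_prod_eq_prod_map_map hX hY.aemeasurable).1 hXY
  rw [hY.map_eq] at hlaw
  calc ∫ ω, F (X ω) (Y ω) ∂P
      = ∫ q, F q.1 q.2 ∂(P.map fun ω => (X ω, Y ω)) := by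
        rw [integral_map (hX.prodMk hY.aemeasurable) (by rw [hlaw]; exact hint.1)]
    _ = ∫ x, (Fintype.card β : ℂ)⁻¹ * ∑ b, F x b ∂(P.map X) := by
        rw [hlaw, integral_prod _ hint]
        congr 1 with x
        rw [integral_fintype .of_finite, Finset.mul_sum]
        refine Finset.sum_congr rfl fun b _ => ?_
        simp [measureReal_def, uniformOn_univ]
    _ = _ := integral_map hX (Integrable.of_finite).1

variable {d : ℕ} {Ω : Type*} [MeasurableSpace Ω] {P : Measure Ω} {ξ : ℕ → Ω → Letter d}

lemma exists_word_eq_comp (hd : 2 ≤ d) (n : ℕ) :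
    ∃ f : (Finset.range n → Letter d) → List (Letter d),
      ∀ x : ℕ → Letter d, word x n = f fun i => x i := by
  -- The padding letter is irrelevant: `word x n` reads only indices below `n`.
  refine ⟨fun y => word (fun i => if h : i ∈ Finset.range n then y ⟨i, h⟩
    else (⟨0, by omega⟩, true)) n, fun x => word_congr fun i hi => ?_⟩
  simp [hi]

lemma integral_word [IsProbabilityMeasure P] (hd : 2 ≤ d)
    (h_unif : ∀ i, HasLaw (ξ i) (uniformOn Set.univ) P)
    (h_indep : iIndepFun ξ P) (n : ℕ) (F : List (Letter d) → ℂ) :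
    ∫ ω, F (word (fun i => ξ i ω) n) ∂P = (transition d ^ n) F [] := by
  have : Nonempty (Letter d) := ⟨(⟨0, by omega⟩, true)⟩
  induction n generalizing F with
  | zero => simp [word]
  | succ n ih =>
    obtain ⟨f, hf⟩ := exists_word_eq_comp hd n
    have hmeas (i : ℕ) : AEMeasurable (ξ i) P := (h_unif i).aemeasurable
    have hind : IndepFun (fun ω (i : Finset.range n) => ξ i ω) (ξ n) P :=
      (h_indep.indepFun_finset₀ (Finset.range n) {n} (by simp) hmeas).comp
        (φ := id) (ψ := fun y : ({n} : Finset ℕ) → Letter d => y ⟨n, by simp⟩) measurable_id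
        (measurable_pi_apply (⟨n, by simp⟩ : ({n} : Finset ℕ)))
    rw [pow_succ, Module.End.mul_apply, ← ih]
    simp only [word, hf]
    rw [integral_indepFun_uniform (X := fun ω (i : Finset.range n) => ξ i ω)
      (aemeasurable_pi_lambda _ fun i => hmeas i) (h_unif n) hind
      fun x a => F (step (flip a) (f x))]
    congr 1 with ω
    rw [transition_apply, card_letter]
    push_cast
    congr 1
    -- The chain prepends inverse letters, and inversion permutes the alphabet.
    exact (Function.Involutive.bijective flip_flip).sum_comp fun a => F (step a (f fun i => ξ i ω))

lemma aemeasurable_word_comp (hd : 2 ≤ d) (hmeas : ∀ i, AEMeasurable (ξ i) P) (n : ℕ)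
    (F : List (Letter d) → ℝ) : AEMeasurable (fun ω => F (word (fun i => ξ i ω) n)) P := by
  obtain ⟨f, hf⟩ := exists_word_eq_comp hd n
  simp only [hf]
  exact (measurable_of_finite fun x => F (f x)).comp_aemeasurable
    (aemeasurable_pi_lambda _ fun i => hmeas i)

/-- A central limit theorem for a statistic of the reduced word, from its characteristic function. -/
lemma tendstoInDistribution_of_transition [IsProbabilityMeasure P] (hd : 2 ≤ d)
    (h_unif : ∀ i, HasLaw (ξ i) (uniformOn Set.univ) P) (h_indep : iIndepFun ξ P)
    (K : List (Letter d) → ℕ) {m v : ℝ} (hv : 0 ≤ v)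
    (h : ∀ t : ℝ, Tendsto (fun n : ℕ =>
      (transition d ^ n) (fun w => Complex.exp (↑(t / √n) * Complex.I) ^ K w) [] *
        Complex.exp (-m * ↑(t / √n) * Complex.I) ^ n) atTop
      (nhds (Complex.exp (-(v * t ^ 2 / 2))))) :
    TendstoInDistribution
      (fun (n : ℕ) (ω : Ω) => ((K (word (fun i => ξ i ω) n) : ℝ) - m * n) / √(n : ℝ))
      atTop (id : ℝ → ℝ) (fun _ => P) (gaussianReal 0 (Real.toNNReal v)) where
  forall_aemeasurable n := aemeasurable_word_comp hd (fun i => (h_unif i).aemeasurable) n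
    fun w => ((K w : ℝ) - m * n) / √(n : ℝ)
  aemeasurable_limit := aemeasurable_id
  tendsto := by
    refine ProbabilityMeasure.tendsto_iff_tendsto_charFun.2 fun t => ?_
    have hlim : charFun (gaussianReal 0 (Real.toNNReal v)) t =
        Complex.exp (-(v * t ^ 2 / 2)) := by
      rw [charFun_gaussianReal]
      simp [hv]
    simp only [ProbabilityMeasure.coe_mk, Measure.map_id, hlim]
    refine (h t).congr fun n => ?_
    rw [charFun_apply_real, integral_map (aemeasurable_word_comp hd
      (fun i => (h_unif i).aemeasurable) n fun w => ((K w : ℝ) - m * n) / √(n : ℝ))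
      (by fun_prop), ← integral_word hd h_unif h_indep, ← integral_mul_const]
    congr 1 with ω
    rw [← Complex.exp_nat_mul, ← Complex.exp_nat_mul, ← Complex.exp_add]
    congr 1
    push_cast
    ring

end ReducedWalk

theorem theorem4p2 (d : ℕ) (hd : 2 ≤ d)
    {Ω : Type*} [MeasurableSpace Ω] (P : Measure Ω) [IsProbabilityMeasure P]
    (ξ : ℕ → Ω → ReducedWalk.Letter d)
    (h_unif : ∀ i, HasLaw (ξ i) (uniformOn Set.univ) P)
    (h_indep : iIndepFun ξ P) :
    TendstoInDistribution
      (fun (n : ℕ) (ω : Ω) =>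
        ((ReducedWalk.reducedLength (fun i => ξ i ω) n : ℝ) - ((d : ℝ) - 1) / d * n) / √(n : ℝ))
      atTop (id : ℝ → ℝ) (fun _ => P)
      (gaussianReal 0 (Real.toNNReal ((2 * (d : ℝ) - 1) / (d : ℝ) ^ 2))) ∧
    TendstoInDistribution
      (fun (n : ℕ) (ω : Ω) =>
        ((ReducedWalk.numTurns (fun i => ξ i ω) n : ℝ)
          - 2 * ((d : ℝ) - 1) ^ 2 / (d * (2 * (d : ℝ) - 1)) * n) / √(n : ℝ))
      atTop (id : ℝ → ℝ) (fun _ => P)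
      (gaussianReal 0 (Real.toNNReal
        (2 * ((d : ℝ) - 1) ^ 2 * (5 * (d : ℝ) - 2) / ((d : ℝ) ^ 2 * (2 * (d : ℝ) - 1) ^ 2)))) := by
  have hd' : (2 : ℝ) ≤ d := by exact_mod_cast hd
  have hd0 : (d : ℝ) ≠ 0 := by positivity
  have hd1 : 2 * (d : ℝ) - 1 ≠ 0 := by linarith
  constructor
  · have hm : ((d : ℝ) - 1) / d = ReducedWalk.speed d 1 := by simp [ReducedWalk.speed]
    have hv : (2 * (d : ℝ) - 1) / (d : ℝ) ^ 2 = ReducedWalk.asympVar d 1 := by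
      rw [ReducedWalk.asympVar, ← hm]
      field_simp
      ring
    have hpos : 0 ≤ (2 * (d : ℝ) - 1) / (d : ℝ) ^ 2 :=
      div_nonneg (by linarith) (by positivity)
    simp only [← ReducedWalk.length_word]
    refine ReducedWalk.tendstoInDistribution_of_transition hd h_unif h_indep List.length hpos
      fun t => ?_
    rw [hm, hv]
    convert ReducedWalk.tendsto_powLength hd 1 t using 5
    simp [ReducedWalk.powLength, ReducedWalk.bernoulliChar]
  · set p : ℝ := (2 * d - 2) / (2 * d - 1) with hp
    have hm : 2 * ((d : ℝ) - 1) ^ 2 / (d * (2 * (d : ℝ) - 1)) = ReducedWalk.speed d p := by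
      rw [ReducedWalk.speed, hp]
      field_simp
    have hv : 2 * ((d : ℝ) - 1) ^ 2 * (5 * (d : ℝ) - 2) / ((d : ℝ) ^ 2 * (2 * (d : ℝ) - 1) ^ 2) =
        ReducedWalk.asympVar d p := by
      rw [ReducedWalk.asympVar, ← hm, hp]
      field_simp
      ring
    have hpos : 0 ≤ 2 * ((d : ℝ) - 1) ^ 2 * (5 * (d : ℝ) - 2) /
        ((d : ℝ) ^ 2 * (2 * (d : ℝ) - 1) ^ 2) :=
      div_nonneg (mul_nonneg (by positivity) (by linarith)) (by positivity)
    simp only [← ReducedWalk.turns_word]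
    refine ReducedWalk.tendstoInDistribution_of_transition hd h_unif h_indep ReducedWalk.turns hpos
      fun t => ?_
    rw [hm, hv]
    exact ReducedWalk.tendsto_powTurns hd t hp
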